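/- Let $p$ be a prime, $m\ge 1$, $q=p^m$, and let $\mathbb F_q$ be the field with $q$ elements. Let $n=Np^t$ with $N\ge 1$, $p\nmid N$, $t\ge 0$, and let $\alpha$ be a primitive $N$-th root of unity in an extension field of $\mathbb F_q$. For $a\in\mathbb Z_N$ let $C_q(a)=\{q^i a : i\ge 0\}\subseteq\mathbb Z_N$ be its $q$-cyclotomic coset and let $f_a(x)=\prod_{i\in C_q(a)}(x-\alpha^i)\in\mathbb F_q[x]$. For a polynomial $f$ of degree $k$ with $f(0)\neq 0$ let $f^*(x)=f(0)^{-1}x^k f(1/x)$. Let $G_{(q,1)}$ be the set of positive integers $d$ such that $d\mid q^k+1$ for some integer $k\ge 1$. For $d\mid N$ let $\gamma_d=\varphi(d)/\mathrm{ord}_d(q)$, and let $a_{d1},\dots,a_{d\gamma_d}$ be a complete set of representatives of the $q$-cyclotomic cosets consisting of elements of additive order $d$ in $\mathbb Z_N$. If $d\notin G_{(q,1)}$, let the representatives be arranged so that each element of additive order $d$ belongs to $C_q(a_{dj})\cup C_q(-a_{dj})$ for exactly one $j\in\{1,\dots,\gamma_d/2\}$; this is the arrangement for which $$x^n-1=\prod_{\substack{d\mid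 N\\ d\in G_{(q,1)}}}\prod_{j=1}^{\gamma_d}f_{a_{dj}}(x)^{p^t}\prod_{\substack{d\mid N\\ d\notin G_{(q,1)}}}\prod_{j=1}^{\gamma_d/2}f_{a_{dj}}(x)^{p^t}f_{a_{dj}}^*(x)^{p^t}.$$ Let $C\subseteq\mathbb F_q^n$ be a cyclic code whose generator polynomial (the monic divisor of $x^n-1$ generating the ideal of $\mathbb F_q[x]/\langle x^n-1\rangle$ that corresponds to $C$ under $(c_0,\dots,c_{n-1})\mapsto\sum_i c_ix^i$) is $$g(x)=\prod_{\substack{d\mid N\\ d\in G_{(q,1)}}}\prod_{j=1}^{\gamma_d}f_{a_{dj}}(x)^{r_{dj}}\prod_{\substack{d\mid N\\ d\notin G_{(q,1)}}}\prod_{j=1}^{\gamma_d/2}f_{a_{dj}}(x)^{s_{dj}}f_{a_{dj}}^*(x)^{s'_{dj}},$$ with non-negative integers $r_{dj},s_{dj},s'_{dj}$. Then $C$ is Euclidean complementary dual, that is, $C\cap C^{\perp}=\{0\}$ where $C^\perp=\{x\in\mathbb F_q^n : \sum_i x_ic_i=0 \text{ for all } c\in C\}$, if and only if $r_{dj}\in\{0,p^t\}$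 for all $d\mid N$ with $d\in G_{(q,1)}$ and $1\le j\le\gamma_d$, and $(s_{dj},s'_{dj})\in\{(0,0),(p^t,p^t)\}$ for all $d\mid N$ with $d\notin G_{(q,1)}$ and $1\le j\le\gamma_d/2$. -/

import Mathlib

open Polynomial

/-- `goodIntegers a b` is the set of positive integers dividing `a ^ k + b ^ k` for some
positive integer `k`. -/
def goodIntegers (a b : ℤ) : Set ℕ :=
  {d | 0 < d ∧ ∃ k : ℕ, 0 < k ∧ (d : ℤ) ∣ a ^ k + b ^ k}

open Classical in
/-- The `q`-cyclotomic coset `{q ^ i • a | i = 0, 1, 2, …}` of `ZMod N` containing `a`. -/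
noncomputable def cyclotomicCoset (q : ℕ) {N : ℕ} [NeZero N] (a : ZMod N) : Finset (ZMod N) :=
  Finset.univ.filter fun b => ∃ i : ℕ, b = q ^ i • a

/-- The number `φ(d) / ord_d(q)`. -/
noncomputable def numCosets (q d : ℕ) : ℕ :=
  Nat.totient d / orderOf (q : ZMod d)

/-- The index `j` among the first `γ / 2` elements of `Fin γ`, regarded in `Fin γ`. -/
def firstHalf {k : ℕ} (j : Fin (k / 2)) : Fin k :=
  Fin.castLE (Nat.div_le_self k 2) j

/-- For every divisor `d` of `N`, the elements `a d 0, a d 1, …` form a complete set of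
representatives of the `q`-cyclotomic cosets of elements of additive order `d`; and, if `d` is not
good with respect to `q` and `1`, they are arranged so that every element of additive order `d` lies
in the union of the cosets of `a d j` and `-a d j` for exactly one `j` in the first half of
the indices. -/
structure IsCosetArrangement (q : ℕ) {N : ℕ} [NeZero N]
    (a : (d : ℕ) → Fin (numCosets q d) → ZMod N) : Prop where
  addOrderOf_eq : ∀ d, d ∣ N → ∀ j, addOrderOf (a d j) = d
  existsUnique_mem : ∀ d, d ∣ N → ∀ b : ZMod N, addOrderOf b = d →
    ∃! j : Fin (numCosets q d), b ∈ cyclotomicCoset q (a d j)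
  existsUnique_pair : ∀ d, d ∣ N → d ∉ goodIntegers q 1 → ∀ b : ZMod N, addOrderOf b = d →
    ∃! j : Fin (numCosets q d / 2),
      b ∈ cyclotomicCoset q (a d (firstHalf j)) ∨ b ∈ cyclotomicCoset q (-a d (firstHalf j))

/-- The product of `X - α ^ i` over the `q`-cyclotomic coset of `a`, for `α` a primitive `N`-th root
of unity in an extension of the field with `q` elements, has coefficients in that field. -/
theorem exists_map_eq_cosetProd {F E : Type*} [Field F] [Field E] [Algebra F E] {q N : ℕ}
    [NeZero N] (hF : Nat.card F = q) (hq : q ≠ 0) {α : E} (hα : IsPrimitiveRoot α N)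
    (a : ZMod N) :
    ∃ f : F[X], f.map (algebraMap F E) =
      ∏ i ∈ cyclotomicCoset q a, (X - C (α ^ i.val)) := by
  classical
  subst hF
  have : Finite F := Nat.finite_of_card_ne_zero hq
  have := Fintype.ofFinite F
  set σ : E →+* E := (FiniteField.frobeniusAlgHom F E).toRingHom with hσdef
  have hσ : ∀ x : E, σ x = x ^ Nat.card F := by
    intro x
    rw [Nat.card_eq_fintype_card]
    rfl
  have hval : ∀ i : ZMod N, α ^ ((Nat.card F) • i).val = (α ^ i.val) ^ (Nat.card F) := by
    intro i
    rw [← pow_mul, nsmul_eq_mul, ZMod.val_mul, ZMod.val_natCast, ← pow_mod_orderOf α (i.val * _),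
      ← hα.eq_orderOf, Nat.mod_mul_mod, mul_comm]
  have hinj : Function.Injective fun i : ZMod N => (Nat.card F) • i := by
    intro i j hij
    have h : (α ^ i.val) ^ (Nat.card F) = (α ^ j.val) ^ (Nat.card F) := by
      rw [← hval, ← hval]
      exact congrArg (fun x : ZMod N => α ^ x.val) hij
    have h2 : α ^ i.val = α ^ j.val := σ.injective (by rw [hσ, hσ, h])
    exact ZMod.val_injective N (hα.pow_inj (ZMod.val_lt i) (ZMod.val_lt j) h2)
  set P : E[X] := ∏ i ∈ cyclotomicCoset (Nat.card F) a, (X - C (α ^ i.val)) with hP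
  have himg : (cyclotomicCoset (Nat.card F) a).image (fun i => (Nat.card F) • i) =
      cyclotomicCoset (Nat.card F) a := by
    apply Finset.eq_of_subset_of_card_le
    · intro b hb
      simp only [cyclotomicCoset, Finset.mem_image, Finset.mem_filter, Finset.mem_univ,
        true_and] at hb ⊢
      obtain ⟨c, ⟨i, rfl⟩, rfl⟩ := hb
      exact ⟨i + 1, by rw [pow_succ', mul_smul]⟩
    · rw [Finset.card_image_of_injective _ hinj]
  have hfix : P.map σ = P := by
    conv_rhs => rw [hP, ← himg, Finset.prod_image hinj.injOn]
    rw [hP, Polynomial.map_prod]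
    refine Finset.prod_congr rfl fun i _ => ?_
    rw [hval, Polynomial.map_sub, Polynomial.map_X, Polynomial.map_C, hσ]
  have hlift : P ∈ Polynomial.lifts (algebraMap F E) := by
    rw [Polynomial.lifts_iff_coeff_lifts]
    intro k
    have hk : P.coeff k ^ Fintype.card F = P.coeff k := by
      have h := congrArg (fun Q => Polynomial.coeff Q k) hfix
      simp only [Polynomial.coeff_map, hσ] at h
      rwa [Nat.card_eq_fintype_card] at h
    have hs : (X ^ Fintype.card F - X : F[X]).Splits := by
      rw [Polynomial.splits_iff_card_roots, FiniteField.roots_X_pow_card_sub_X,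
        FiniteField.X_pow_card_sub_X_natDegree_eq F Fintype.one_lt_card]
      rfl
    refine hs.mem_range_of_isRoot
      (FiniteField.X_pow_card_sub_X_ne_zero F Fintype.one_lt_card) ?_
    simp [hk]
  exact (Polynomial.mem_lifts _).1 hlift

/-- The polynomial over the field with `q` elements determined by the `q`-cyclotomic coset of `a`:
it is the product of `X - α ^ i` over that coset, where `α` is a primitive `N`-th root of unity. -/
noncomputable def cosetPoly {F E : Type*} [Field F] [Field E] [Algebra F E] {q N : ℕ}
    [NeZero N] (hF : Nat.card F = q) (hq : q ≠ 0) {α : E} (hα : IsPrimitiveRoot α N)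
    (a : ZMod N) : F[X] :=
  (exists_map_eq_cosetProd hF hq hα a).choose

theorem map_cosetPoly {F E : Type*} [Field F] [Field E] [Algebra F E] {q N : ℕ}
    [NeZero N] (hF : Nat.card F = q) (hq : q ≠ 0) {α : E} (hα : IsPrimitiveRoot α N)
    (a : ZMod N) :
    (cosetPoly hF hq hα a).map (algebraMap F E) =
      ∏ i ∈ cyclotomicCoset q a, (X - C (α ^ i.val)) :=
  (exists_map_eq_cosetProd hF hq hα a).choose_spec

/-- The reciprocal polynomial `f₀⁻¹ x ^ k f(1 / x)` of a polynomial `f` of degree `k` with constant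
coefficient `f₀ ≠ 0`. -/
noncomputable def reciprocalPoly {F : Type*} [Field F] (f : F[X]) : F[X] :=
  C (f.coeff 0)⁻¹ * f.reverse

/-- The Euclidean dual of a linear code. -/
def euclideanDual {F : Type*} [Field F] {n : ℕ} (C : Submodule F (Fin n → F)) :
    Submodule F (Fin n → F) where
  carrier := {x | ∀ c ∈ C, ∑ i, x i * c i = 0}
  zero_mem' := by intro c _; simp
  add_mem' := by
    intro x y hx hy c hc
    simp [add_mul, Finset.sum_add_distrib, hx c hc, hy c hc]
  smul_mem' := by
    intro k x hx c hc
    simp [mul_assoc, ← Finset.mul_sum, hx c hc]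

/-- A linear code is Euclidean complementary dual if it meets its Euclidean dual trivially. -/
def IsEuclideanComplementaryDual {F : Type*} [Field F] {n : ℕ}
    (C : Submodule F (Fin n → F)) : Prop :=
  C ⊓ euclideanDual C = ⊥

/-- A linear code is cyclic if `(c_{n-1}, c_0, …, c_{n-2}) ∈ C` for all `(c_0, …, c_{n-1}) ∈ C`. -/
def IsCyclicCode {F : Type*} [Field F] {n : ℕ} (C : Submodule F (Fin n → F)) : Prop :=
  ∀ c ∈ C, (fun i => c ((finRotate n).symm i)) ∈ C

/-- The map sending `(c_0, …, c_{n-1})` to the class of `c_0 + c_1 x + … + c_{n-1} x ^ (n-1)`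
in `F[x] / (x ^ n - 1)`. -/
noncomputable def codeToQuotient {F : Type*} [Field F] {n : ℕ} (c : Fin n → F) :
    F[X] ⧸ Ideal.span {(X ^ n - 1 : F[X])} :=
  Ideal.Quotient.mk _ (∑ i : Fin n, C (c i) * X ^ (i : ℕ))

/-- `g` is the generator polynomial of `C`: the monic divisor of `x ^ n - 1` whose class generates
the ideal of `F[x] / (x ^ n - 1)` corresponding to `C`. -/
structure IsGeneratorPolynomial {F : Type*} [Field F] {n : ℕ} (C : Submodule F (Fin n → F))
    (g : F[X]) : Prop where
  monic : g.Monic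
  dvd : g ∣ X ^ n - 1
  image_eq : codeToQuotient '' (C : Set (Fin n → F)) =
    (Ideal.span {Ideal.Quotient.mk (Ideal.span {(X ^ n - 1 : F[X])}) g} :
      Set (F[X] ⧸ Ideal.span {(X ^ n - 1 : F[X])}))

/-! Write `X ^ n - 1 = g * h`. Reading inner products as coefficients of polynomial products modulo
`X ^ n - 1` shows that the dual consists of the words divisible by `h.reverse`. Since `g *
h.reverse` has degree `n` while words have degree below `n`, the intersection is trivial exactly
when `g` and `h.reverse` are coprime (`isEuclideanComplementaryDual_iff_isCoprime`).

Over `E`, Frobenius gives `X ^ n - 1 = (X ^ N - 1) ^ p ^ t`, so each `α ^ i` has multiplicities in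
`g` and `h` summing to `p ^ t`. Reversal inverts roots, so with `v i` the multiplicity of `α ^ i` in
`g`, coprimality says that `v i = 0` or `v (-i) = p ^ t` for every `i`
(`isCoprime_reverse_iff_rootMultiplicity`).

Finally `v` is constant on cyclotomic cosets. Negation preserves a coset of good order and swaps two
disjoint cosets of bad order, so the condition splits into one on each `r d j` and one on each pair
`(s d j, s' d j)` (`forall_eq_zero_or_neg_eq_iff`). -/

section CyclicCodes

/-! ### Cyclic codes, their duals, and coprimality with the reversed check polynomial. -/

variable {F : Type*} [Field F] {n : ℕ}

theorem reverse_dvd_reflect {P B : F[X]} {M : ℕ} (h : P ∣ B) (hB : B.natDegree ≤ M) :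
    P.reverse ∣ B.reflect M := by
  obtain ⟨u, rfl⟩ := h
  by_cases h0 : P * u = 0
  · simp [h0]
  · have hd := natDegree_mul (left_ne_zero_of_mul h0) (right_ne_zero_of_mul h0)
    have hM : M = P.natDegree + (M - P.natDegree) := by omega
    rw [hM, reflect_mul P u le_rfl (by omega)]
    exact dvd_mul_right _ _

theorem reverse_reverse_of_coeff_zero_ne_zero {P : F[X]} (h : P.coeff 0 ≠ 0) :
    P.reverse.reverse = P := by
  have h0 : P.natTrailingDegree = 0 := natTrailingDegree_eq_zero.2 (Or.inr h)
  have hd : P.reverse.natDegree = P.natDegree := by rw [reverse_natDegree, h0, Nat.sub_zero]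
  rw [reverse, hd, reverse, reflect_reflect]

/-- Reflection at `M` is an involution. The nonzero constant term ensures that reversing `P` twice
loses no factor `X`. -/
theorem dvd_reflect_iff_reverse_dvd {P B : F[X]} {M : ℕ} (h : P.coeff 0 ≠ 0)
    (hB : B.natDegree ≤ M) : P ∣ B.reflect M ↔ P.reverse ∣ B := by
  constructor
  · intro hd
    have := reverse_dvd_reflect hd (M := M) (natDegree_reflect_le.trans (by simp [hB]))
    rwa [reflect_reflect] at this
  · intro hd
    have := reverse_dvd_reflect hd hB
    rwa [reverse_reverse_of_coeff_zero_ne_zero h] at this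

/-- The polynomial `c_0 + c_1 x + … + c_{n-1} x ^ (n-1)` of a word. -/
noncomputable def codePoly (c : Fin n → F) : F[X] :=
  ∑ i : Fin n, C (c i) * X ^ (i : ℕ)

theorem coeff_codePoly (c : Fin n → F) (i : Fin n) : (codePoly c).coeff i = c i := by
  simp only [codePoly, finsetSum_coeff, coeff_C_mul, coeff_X_pow, Fin.val_inj]
  simp

theorem degree_codePoly_lt (c : Fin n → F) : (codePoly c).degree < n := by
  refine (degree_sum_le _ _).trans_lt ((Finset.sup_lt_iff (WithBot.bot_lt_coe n)).2 ?_)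
  intro i _
  exact (degree_C_mul_X_pow_le _ _).trans_lt (Nat.cast_lt.2 i.2)

theorem codePoly_coeff {A : F[X]} (hA : A.degree < n) :
    codePoly (fun i : Fin n => A.coeff i) = A := by
  rw [codePoly, Fin.sum_univ_eq_sum_range (fun i => C (A.coeff i) * X ^ i) n]
  ext k
  simp only [finsetSum_coeff, coeff_C_mul, coeff_X_pow]
  by_cases hk : k < n
  · simp [hk]
  · simp [hk, coeff_eq_zero_of_degree_lt (hA.trans_le (by exact_mod_cast not_lt.1 hk))]

theorem codePoly_injective : Function.Injective (codePoly : (Fin n → F) → F[X]) := by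
  intro c c' h
  funext i
  rw [← coeff_codePoly c, h, coeff_codePoly c']

theorem degree_X_pow_sub_one (hn : 0 < n) : (X ^ n - 1 : F[X]).degree = n := by
  simpa using degree_X_pow_sub_C hn (1 : F)

theorem natDegree_le_pred_of_degree_lt {A : F[X]} (hA : A.degree < n) :
    A.natDegree ≤ n - 1 := by
  by_cases h : A = 0
  · simp [h]
  · have := (natDegree_lt_iff_degree_lt h).2 hA
    omega

theorem eq_of_dvd_sub {A B : F[X]} (hn : 0 < n) (hA : A.degree < n) (hB : B.degree < n)
    (h : (X ^ n - 1 : F[X]) ∣ A - B) : A = B := by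
  by_contra hne
  have := degree_le_of_dvd h (sub_ne_zero.2 hne)
  rw [degree_X_pow_sub_one hn] at this
  exact absurd (this.trans_lt ((degree_sub_le A B).trans_lt (max_lt hA hB))) (lt_irrefl _)

/-- As `g` divides `X ^ n - 1`, divisibility by `g` depends only on the class in the quotient, and a
class has only one representative of degree below `n`. -/
theorem mem_iff_dvd_codePoly (hn : 0 < n) {C : Submodule F (Fin n → F)} {g : F[X]}
    (hg : IsGeneratorPolynomial C g) (c : Fin n → F) : c ∈ C ↔ g ∣ codePoly c := by
  have hmem : ∀ c : Fin n → F, codeToQuotient c ∈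
      (Ideal.span {Ideal.Quotient.mk (Ideal.span {(X ^ n - 1 : F[X])}) g}) ↔ g ∣ codePoly c := by
    intro c
    rw [Ideal.mem_span_singleton]
    constructor
    · rintro ⟨u, hu⟩
      obtain ⟨u, rfl⟩ := Ideal.Quotient.mk_surjective u
      rw [← map_mul] at hu
      have := (Ideal.Quotient.mk_eq_mk_iff_sub_mem _ _).1 hu
      rw [Ideal.mem_span_singleton] at this
      have h2 := dvd_add (hg.dvd.trans this) (dvd_mul_right g u)
      rwa [sub_add_cancel] at h2
    · intro h
      exact map_dvd _ h
  constructor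
  · intro hc
    refine (hmem c).1 ?_
    have : codeToQuotient c ∈ codeToQuotient '' (C : Set (Fin n → F)) := ⟨c, hc, rfl⟩
    rwa [hg.image_eq] at this
  · intro h
    have h1 := (hmem c).2 h
    rw [← SetLike.mem_coe, ← hg.image_eq] at h1
    obtain ⟨c', hc', he⟩ := h1
    have := (Ideal.Quotient.mk_eq_mk_iff_sub_mem _ _).1 he
    rw [Ideal.mem_span_singleton] at this
    rwa [← codePoly_injective
      (eq_of_dvd_sub hn (degree_codePoly_lt c') (degree_codePoly_lt c) this)]

theorem sum_mul_eq_coeff_reflect_mul (hn : 0 < n) (x c : Fin n → F) :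
    ∑ i, x i * c i = ((codePoly x).reflect (n - 1) * codePoly c).coeff (n - 1) := by
  rw [coeff_mul, Finset.Nat.sum_antidiagonal_eq_sum_range_succ_mk, Nat.succ_eq_add_one,
    Nat.sub_add_cancel hn, ← Finset.sum_range_reflect, ← Fin.sum_univ_eq_sum_range
    (fun i => ((codePoly x).reflect (n - 1)).coeff (n - 1 - i) *
      (codePoly c).coeff (n - 1 - (n - 1 - i)))]
  refine Finset.sum_congr rfl fun i _ => ?_
  have hi := i.2
  rw [coeff_reflect, revAt_le (by omega), Nat.sub_sub_self (by omega), coeff_codePoly,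
    coeff_codePoly]

/-- Reduction folds exponent `n + k` onto `k`; only exponents `2 * n - 1` and above could reach `n -
1`, and the degree bound excludes them. -/
theorem coeff_modByMonic_X_pow_sub_one (hn : 0 < n) {P : F[X]}
    (hP : P.natDegree ≤ 2 * n - 2) :
    (P %ₘ (X ^ n - 1)).coeff (n - 1) = P.coeff (n - 1) := by
  have hm : (X ^ n - 1 : F[X]).Monic := by simpa using monic_X_pow_sub_C (1 : F) hn.ne'
  have hQ : (P /ₘ (X ^ n - 1)).natDegree ≤ n - 2 := by
    rw [natDegree_divByMonic P hm, natDegree_eq_of_degree_eq_some (degree_X_pow_sub_one hn)]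
    omega
  rw [modByMonic_eq_sub_mul_div P, coeff_sub, sub_mul, one_mul, coeff_sub, mul_comm,
    coeff_mul_X_pow', if_neg (by omega)]
  suffices (P /ₘ (X ^ n - 1)).coeff (n - 1) = 0 by rw [this]; simp
  -- For `n = 1` truncated subtraction makes `n - 2 = n - 1`, so the degree bound is not enough;
  -- there `P` is constant and the quotient is zero.
  rcases Nat.lt_or_ge 1 n with h | h
  · exact coeff_eq_zero_of_natDegree_lt (by omega)
  · have : P /ₘ (X ^ n - 1) = 0 := by
      rw [divByMonic_eq_zero_iff hm, degree_X_pow_sub_one hn]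
      refine (degree_le_of_natDegree_le hP).trans_lt ?_
      exact_mod_cast (by omega : 2 * n - 2 < n)
    rw [this, coeff_zero]

theorem mem_euclideanDual_iff (hn : 0 < n) {C : Submodule F (Fin n → F)} {g : F[X]}
    (hg : IsGeneratorPolynomial C g) (x : Fin n → F) :
    x ∈ euclideanDual C ↔ (X ^ n - 1 : F[X]) ∣ (codePoly x).reflect (n - 1) * g := by
  have hm : (X ^ n - 1 : F[X]).Monic := by simpa using monic_X_pow_sub_C (1 : F) hn.ne'
  set B := (codePoly x).reflect (n - 1)
  have hB : B.natDegree ≤ n - 1 := natDegree_reflect_le.trans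
    (by simp [natDegree_le_pred_of_degree_lt (degree_codePoly_lt x)])
  have key : ∀ c : Fin n → F,
      ∑ i, x i * c i = ((B * codePoly c) %ₘ (X ^ n - 1)).coeff (n - 1) := by
    intro c
    rw [coeff_modByMonic_X_pow_sub_one hn, sum_mul_eq_coeff_reflect_mul hn]
    have := natDegree_le_pred_of_degree_lt (degree_codePoly_lt c)
    exact natDegree_mul_le.trans (by omega)
  constructor
  · intro hx
    rw [← modByMonic_eq_zero_iff_dvd hm]
    set R := (B * g) %ₘ (X ^ n - 1) with hR
    have hRd : R.degree < n := by
      rw [← degree_X_pow_sub_one (F := F) hn]; exact degree_modByMonic_lt _ hm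
    have hRn := natDegree_le_pred_of_degree_lt hRd
    ext k
    rw [coeff_zero]
    by_cases hk : k < n
    -- Pairing with the cyclic shift of `g` by `n - 1 - k` moves coefficient `k` of `R` to position
    -- `n - 1`, so orthogonality to it kills that coefficient.
    · set c : Fin n → F := fun i => ((g * X ^ (n - 1 - k)) %ₘ (X ^ n - 1)).coeff i
      have hcp : codePoly c = (g * X ^ (n - 1 - k)) %ₘ (X ^ n - 1) :=
        codePoly_coeff (by
          rw [← degree_X_pow_sub_one (F := F) hn]; exact degree_modByMonic_lt _ hm)
      have hc : c ∈ C := by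
        rw [mem_iff_dvd_codePoly hn hg, hcp, modByMonic_eq_sub_mul_div]
        exact dvd_sub (dvd_mul_right _ _) (hg.dvd.mul_right _)
      have h0 := hx c hc
      have hmod : (B * codePoly c) %ₘ (X ^ n - 1) =
          (R * X ^ (n - 1 - k)) %ₘ (X ^ n - 1) := by
        rw [hcp]
        rw [← sub_eq_zero, ← sub_modByMonic, modByMonic_eq_zero_iff_dvd hm, hR,
          modByMonic_eq_sub_mul_div, modByMonic_eq_sub_mul_div]
        refine ⟨(B * g /ₘ (X ^ n - 1)) * X ^ (n - 1 - k) -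
          B * (g * X ^ (n - 1 - k) /ₘ (X ^ n - 1)), ?_⟩
        ring
      rw [key, hmod, coeff_modByMonic_X_pow_sub_one hn, coeff_mul_X_pow', if_pos (by omega),
        Nat.sub_sub_self (by omega)] at h0
      · exact h0
      · refine natDegree_mul_le.trans ?_
        rw [natDegree_X_pow]
        omega
    · exact coeff_eq_zero_of_degree_lt (hRd.trans_le (by exact_mod_cast not_lt.1 hk))
  · intro h c hc
    rw [key, (modByMonic_eq_zero_iff_dvd hm).2, coeff_zero]
    obtain ⟨u, hu⟩ := (mem_iff_dvd_codePoly hn hg c).1 hc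
    rw [hu, ← mul_assoc]
    exact h.mul_right u

theorem mem_euclideanDual_iff_reverse_dvd (hn : 0 < n) {C : Submodule F (Fin n → F)} {g h : F[X]}
    (hg : IsGeneratorPolynomial C g) (hgh : g * h = X ^ n - 1) (x : Fin n → F) :
    x ∈ euclideanDual C ↔ h.reverse ∣ codePoly x := by
  have h0 : h.coeff 0 ≠ 0 := by
    intro h0
    have := congrArg (fun P => coeff P 0) hgh
    simp [mul_coeff_zero, h0, coeff_X_pow, hn.ne] at this
  rw [mem_euclideanDual_iff hn hg, ← hgh, mul_comm g h,
    mul_dvd_mul_iff_right hg.monic.ne_zero,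
    dvd_reflect_iff_reverse_dvd h0 (natDegree_le_pred_of_degree_lt (degree_codePoly_lt x))]

/-- A cyclic code is complementary dual exactly when its generator polynomial is coprime to
the reciprocal of its check polynomial. -/
theorem isEuclideanComplementaryDual_iff_isCoprime (hn : 0 < n) {C : Submodule F (Fin n → F)}
    {g h : F[X]} (hg : IsGeneratorPolynomial C g) (hgh : g * h = X ^ n - 1) :
    IsEuclideanComplementaryDual C ↔ IsCoprime g h.reverse := by
  have hnz : (X ^ n - 1 : F[X]) ≠ 0 := by
    simpa using (monic_X_pow_sub_C (1 : F) hn.ne').ne_zero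
  have hh : h ≠ 0 := right_ne_zero_of_mul (hgh ▸ hnz)
  have h0 : h.coeff 0 ≠ 0 := by
    intro h0
    have := congrArg (fun P => coeff P 0) hgh
    simp [mul_coeff_zero, h0, coeff_X_pow, hn.ne] at this
  have hdeg : (g * h.reverse).degree = n := by
    rw [← degree_X_pow_sub_one (F := F) hn, ← hgh, degree_mul, degree_mul,
      degree_eq_natDegree hh, degree_eq_natDegree (mt reverse_eq_zero.1 hh), reverse_natDegree,
      natTrailingDegree_eq_zero.2 (Or.inr h0), Nat.sub_zero]
  have hmem : ∀ x, x ∈ C ⊓ euclideanDual C ↔ g ∣ codePoly x ∧ h.reverse ∣ codePoly x := by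
    intro x
    rw [Submodule.mem_inf, mem_iff_dvd_codePoly hn hg,
      mem_euclideanDual_iff_reverse_dvd hn hg hgh]
  constructor
  · intro hC
    by_contra hco
    obtain ⟨z, hz, ⟨u, hu⟩, ⟨v, hv⟩⟩ : ∃ z, ¬ IsUnit z ∧ z ∣ g ∧ z ∣ h.reverse := by
      by_contra hcon
      push Not at hcon
      refine hco (isCoprime_of_prime_dvd (fun h => hg.monic.ne_zero h.1) fun z hz h1 h2 => ?_)
      exact hcon z hz.not_isUnit h1 h2
    -- Dividing `g * h.reverse` by the common factor `z` leaves a nonzero common multiple of degree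
    -- below `n`: a nonzero word in the intersection.
    set A := z * u * v
    have hA : g * h.reverse = z * A := by rw [hu, hv]; ring
    have hne : z * A ≠ 0 := hA ▸ mul_ne_zero hg.monic.ne_zero (mt reverse_eq_zero.1 hh)
    have hAd : A.degree < n := by
      have hA0 := right_ne_zero_of_mul hne
      have hz0 := left_ne_zero_of_mul hne
      have hzd := natDegree_pos_iff_degree_pos.2 (degree_pos_of_ne_zero_of_nonunit hz0 hz)
      rw [hA, degree_eq_natDegree hne] at hdeg
      have hd := natDegree_mul hz0 hA0
      have hn' : (z * A).natDegree = n := by exact_mod_cast hdeg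
      rw [degree_eq_natDegree hA0]
      exact_mod_cast (by omega : A.natDegree < n)
    have hAx := codePoly_coeff hAd
    have hx : (fun i : Fin n => A.coeff i) ∈ C ⊓ euclideanDual C := by
      rw [hmem, hAx, hu, hv]
      exact ⟨⟨v, rfl⟩, ⟨u, by ring⟩⟩
    rw [hC, Submodule.mem_bot] at hx
    rw [hx] at hAx
    exact right_ne_zero_of_mul hne (by rw [← hAx]; simp [codePoly])
  · intro hco
    rw [IsEuclideanComplementaryDual, eq_bot_iff]
    intro x hx
    obtain ⟨h1, h2⟩ := (hmem x).1 hx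
    have h3 := hco.mul_dvd h1 h2
    have h4 : codePoly x = 0 := by
      by_contra hne
      have := degree_le_of_dvd h3 hne
      rw [hdeg] at this
      exact absurd (degree_codePoly_lt x) (not_lt.2 this)
    rw [Submodule.mem_bot]
    exact codePoly_injective (h4.trans (by simp [codePoly]))

end CyclicCodes

/-! ### Root multiplicities of powers and products. -/

section RootMultiplicity

variable {R : Type*} [CommRing R] [IsDomain R]

theorem rootMultiplicity_pow_eq_mul (x : R) (P : R[X]) (k : ℕ) :
    rootMultiplicity x (P ^ k) = k * rootMultiplicity x P := by
  classical
  rw [← count_roots, roots_pow, Multiset.count_nsmul, count_roots]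

theorem rootMultiplicity_finsetProd {ι : Type*} (x : R) (S : Finset ι) (P : ι → R[X])
    (h : ∀ i ∈ S, P i ≠ 0) :
    rootMultiplicity x (∏ i ∈ S, P i) = ∑ i ∈ S, rootMultiplicity x (P i) := by
  classical
  induction S using Finset.induction_on with
  | empty => simp
  | insert a S ha ih =>
    have hS : ∏ i ∈ S, P i ≠ 0 :=
      Finset.prod_ne_zero_iff.2 fun i hi => h i (Finset.mem_insert_of_mem hi)
    rw [Finset.prod_insert ha, Finset.sum_insert ha, rootMultiplicity_mul
      (mul_ne_zero (h a (Finset.mem_insert_self _ _)) hS),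
      ih fun i hi => h i (Finset.mem_insert_of_mem hi)]

end RootMultiplicity

/-! ### Reciprocal polynomials. -/

section Reciprocal

variable {F E : Type*} [Field F] [Field E]

theorem map_reciprocalPoly (φ : F →+* E) (f : F[X]) :
    (reciprocalPoly f).map φ = reciprocalPoly (f.map φ) := by
  rw [reciprocalPoly, reciprocalPoly, Polynomial.map_mul, map_C, map_inv₀, coeff_map, reverse,
    reverse, reflect_map, natDegree_map]

theorem reciprocalPoly_mul (f g : F[X]) :
    reciprocalPoly (f * g) = reciprocalPoly f * reciprocalPoly g := by
  rw [reciprocalPoly, reciprocalPoly, reciprocalPoly, mul_coeff_zero, mul_inv, C_mul,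
    reverse_mul_of_domain]
  ring

theorem reciprocalPoly_one : reciprocalPoly (1 : F[X]) = 1 := by
  rw [reciprocalPoly, ← C_1, reverse_C]
  simp

theorem reciprocalPoly_prod {ι : Type*} (S : Finset ι) (f : ι → F[X]) :
    reciprocalPoly (∏ i ∈ S, f i) = ∏ i ∈ S, reciprocalPoly (f i) := by
  classical
  induction S using Finset.induction_on with
  | empty => simpa using reciprocalPoly_one
  | insert a S ha ih => rw [Finset.prod_insert ha, Finset.prod_insert ha, reciprocalPoly_mul, ih]

theorem reciprocalPoly_X_sub_C {u : F} (hu : u ≠ 0) :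
    reciprocalPoly (X - C u) = X - C u⁻¹ := by
  have hr : (X - C u).reverse = 1 - C u * X := by
    rw [reverse, natDegree_X_sub_C, reflect_sub, reflect_one_X, reflect_C, pow_one]
  rw [reciprocalPoly, hr]
  simp only [coeff_sub, coeff_X_zero, coeff_C_zero, zero_sub, inv_neg, C_neg]
  have : C u⁻¹ * C u = (1 : F[X]) := by rw [← C_mul, inv_mul_cancel₀ hu, C_1]
  linear_combination X * this

end Reciprocal

theorem ZMod.addOrderOf_dvd_modulus {N : ℕ} (a : ZMod N) : addOrderOf a ∣ N :=
  addOrderOf_dvd_of_nsmul_eq_zero (by simp)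

/-! ### Cyclotomic cosets, negation and good integers. -/

section Cosets

variable {q N : ℕ} [NeZero N]

theorem mem_cyclotomicCoset {a b : ZMod N} :
    b ∈ cyclotomicCoset q a ↔ ∃ i : ℕ, b = q ^ i • a := by
  simp [cyclotomicCoset]

theorem mem_cyclotomicCoset_self (a : ZMod N) : a ∈ cyclotomicCoset q a :=
  mem_cyclotomicCoset.2 ⟨0, by simp⟩

theorem neg_mem_cyclotomicCoset_neg {a b : ZMod N} :
    -b ∈ cyclotomicCoset q (-a) ↔ b ∈ cyclotomicCoset q a := by
  simp [mem_cyclotomicCoset, smul_neg]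

theorem neg_mem_cyclotomicCoset {a b : ZMod N} :
    -b ∈ cyclotomicCoset q a ↔ b ∈ cyclotomicCoset q (-a) := by
  rw [← neg_mem_cyclotomicCoset_neg, neg_neg]

theorem addOrderOf_eq_of_mem_cyclotomicCoset (hq : q.Coprime N) {a b : ZMod N}
    (h : b ∈ cyclotomicCoset q a) : addOrderOf b = addOrderOf a := by
  obtain ⟨i, rfl⟩ := mem_cyclotomicCoset.1 h
  exact Nat.Coprime.addOrderOf_nsmul
    ((hq.pow_left i).symm.coprime_dvd_left (ZMod.addOrderOf_dvd_modulus a))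

/-- If the order of `a` divides `q ^ k + 1`, multiplication by `q ^ k` acts on multiples of `a` as
negation. -/
theorem neg_mem_cyclotomicCoset_of_mem_goodIntegers {a b : ZMod N}
    (ha : addOrderOf a ∈ goodIntegers q 1) (hb : b ∈ cyclotomicCoset q a) :
    -b ∈ cyclotomicCoset q a := by
  obtain ⟨_, k, _, hd⟩ := ha
  obtain ⟨i, rfl⟩ := mem_cyclotomicCoset.1 hb
  refine mem_cyclotomicCoset.2 ⟨i + k, ?_⟩
  have hd' : addOrderOf a ∣ q ^ k + 1 := by
    rw [one_pow] at hd
    exact_mod_cast hd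
  have h0 := addOrderOf_dvd_iff_nsmul_eq_zero.1 hd'
  rw [add_smul, one_smul] at h0
  rw [pow_add, mul_smul, eq_neg_of_add_eq_zero_left h0, smul_neg]

/-- A common element gives `d ∣ q ^ i + q ^ k`; since `q` is a unit modulo `d`, cancelling a power
of `q` leaves `d ∣ q ^ (l + 1) + 1`. -/
theorem addOrderOf_mem_goodIntegers (hq : q.Coprime N) {a b : ZMod N}
    (h1 : b ∈ cyclotomicCoset q a) (h2 : b ∈ cyclotomicCoset q (-a)) :
    addOrderOf a ∈ goodIntegers q 1 := by
  set d := addOrderOf a with hd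
  have hdN : d ∣ N := ZMod.addOrderOf_dvd_modulus a
  have hd0 : 0 < d := Nat.pos_of_dvd_of_pos hdN (Nat.pos_of_neZero N)
  have hqd : q.Coprime d := hq.coprime_dvd_right hdN
  obtain ⟨i, rfl⟩ := mem_cyclotomicCoset.1 h1
  obtain ⟨k, hk⟩ := mem_cyclotomicCoset.1 h2
  have hsum : d ∣ q ^ i + q ^ k := by
    rw [hd, addOrderOf_dvd_iff_nsmul_eq_zero, add_smul, hk, smul_neg, neg_add_cancel]
  have hφ : 0 < d.totient := Nat.totient_pos.2 hd0
  -- By Euler's theorem `k` may be raised beyond `i`, so that the exponent left after cancelling `q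
  -- ^ i` is positive.
  have hmod : q ^ (k + d.totient * (i + 1)) ≡ q ^ k [MOD d] := by
    have := ((Nat.ModEq.pow_totient hqd).pow (i + 1)).mul_left (q ^ k)
    rwa [one_pow, mul_one, ← pow_mul, ← pow_add] at this
  have hle : i + 1 ≤ k + d.totient * (i + 1) := by nlinarith
  obtain ⟨l, hl⟩ := Nat.exists_eq_add_of_le hle
  have hsum' : d ∣ q ^ i * (q ^ (l + 1) + 1) := by
    have h : q ^ i * (q ^ (l + 1) + 1) = q ^ i + q ^ (k + d.totient * (i + 1)) := by
      rw [hl, mul_add, ← pow_add]; ring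
    rw [h]
    exact (hmod.add_left (q ^ i)).symm.dvd_iff dvd_rfl |>.1 hsum
  refine ⟨hd0, l + 1, Nat.succ_pos l, ?_⟩
  have := ((hqd.pow_left i).symm).dvd_of_dvd_mul_left hsum'
  rw [one_pow]
  exact_mod_cast this

end Cosets

/-! ### Coprimality in terms of multiplicities at powers of a primitive root. -/

section PrimitiveRoot

variable {E : Type*} [Field E] {N : ℕ} [NeZero N] {α : E}

theorem IsPrimitiveRoot.pow_val_neg (hα : IsPrimitiveRoot α N) (i : ZMod N) :
    α ^ (-i).val = (α ^ i.val)⁻¹ := by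
  refine eq_inv_of_mul_eq_one_left ?_
  rw [← pow_add, ← pow_mod_orderOf, ← hα.eq_orderOf, ← ZMod.val_add, neg_add_cancel,
    ZMod.val_zero, pow_zero]

theorem IsPrimitiveRoot.pow_val_injective (hα : IsPrimitiveRoot α N) :
    Function.Injective fun i : ZMod N => α ^ i.val := fun i j h =>
  ZMod.val_injective N (hα.pow_inj (ZMod.val_lt i) (ZMod.val_lt j) h)

theorem IsPrimitiveRoot.exists_pow_val_eq (hα : IsPrimitiveRoot α N) {ζ : E} (h : ζ ^ N = 1) :
    ∃ i : ZMod N, α ^ i.val = ζ := by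
  obtain ⟨i, hi, rfl⟩ := hα.eq_pow_of_pow_eq_one h
  exact ⟨i, by rw [ZMod.val_natCast, Nat.mod_eq_of_lt hi]⟩

theorem IsPrimitiveRoot.rootMultiplicity_X_pow_sub_one (hα : IsPrimitiveRoot α N)
    (i : ZMod N) : rootMultiplicity (α ^ i.val) (X ^ N - 1 : E[X]) = 1 := by
  classical
  rw [← count_roots, ← C_1]
  refine Multiset.count_eq_one_of_mem hα.nthRoots_one_nodup ?_
  refine (mem_nthRoots (Nat.pos_of_neZero N)).2 ?_
  rw [← pow_mul, mul_comm, pow_mul, hα.pow_eq_one, one_pow]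

theorem IsPrimitiveRoot.exists_associated_of_prime_dvd (hα : IsPrimitiveRoot α N) {k : ℕ}
    {z : E[X]} (hz : Prime z) (h : z ∣ (X ^ N - 1) ^ k) :
    ∃ i : ZMod N, Associated z (X - C (α ^ i.val)) := by
  have h1 := hz.dvd_of_dvd_pow h
  rw [X_pow_sub_one_eq_prod (Nat.pos_of_neZero N) hα] at h1
  obtain ⟨ζ, hζ, hd⟩ := hz.exists_mem_finset_dvd h1
  obtain ⟨i, rfl⟩ := hα.exists_pow_val_eq ((Polynomial.mem_nthRootsFinset (Nat.pos_of_neZero N) 1).1 hζ)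
  exact ⟨i, hz.irreducible.associated_of_dvd (irreducible_X_sub_C _) hd⟩

theorem isRoot_reverse_inv_iff {P : E[X]} {x : E} (hx : x ≠ 0) :
    P.reverse.IsRoot x⁻¹ ↔ P.IsRoot x := by
  have := invertibleOfNonzero hx
  have := eval₂_reverse_eq_zero_iff (RingHom.id E) x P
  rwa [invOf_eq_inv] at this

/-- Coprimality of a divisor `g` of `X ^ n - 1` with the reciprocal of its cofactor, in terms of
the multiplicities of the roots of `g`. -/
theorem isCoprime_reverse_iff_rootMultiplicity (hα : IsPrimitiveRoot α N) {k : ℕ} {g h : E[X]}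
    (hgh : g * h = (X ^ N - 1) ^ k) :
    IsCoprime g h.reverse ↔ ∀ i : ZMod N,
      rootMultiplicity (α ^ i.val) g = 0 ∨ rootMultiplicity (α ^ (-i).val) g = k := by
  have hne : g * h ≠ 0 := by
    rw [hgh]
    refine pow_ne_zero _ ?_
    simpa using (monic_X_pow_sub_C (1 : E) (NeZero.ne N)).ne_zero
  have hg := left_ne_zero_of_mul hne
  have hh := right_ne_zero_of_mul hne
  -- Each `α ^ i` is a simple root of `X ^ N - 1`, so `α ^ (-i)` is a root of `h` exactly when its
  -- multiplicity in `g` is not `k`.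
  have hadd : ∀ i : ZMod N, rootMultiplicity (α ^ i.val) g + rootMultiplicity (α ^ i.val) h = k := by
    intro i
    rw [← rootMultiplicity_mul hne, hgh, rootMultiplicity_pow_eq_mul,
      hα.rootMultiplicity_X_pow_sub_one, mul_one]
  have hα0 : ∀ i : ZMod N, α ^ i.val ≠ 0 := fun i => pow_ne_zero _ (hα.ne_zero (NeZero.ne N))
  have hrev : ∀ i : ZMod N, h.reverse.IsRoot (α ^ i.val) ↔ h.IsRoot (α ^ (-i).val) := by
    intro i
    rw [← isRoot_reverse_inv_iff (hα0 (-i)), hα.pow_val_neg, inv_inv]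
  constructor
  · rintro ⟨u, v, huv⟩ i
    by_contra! hcon
    have h1 : g.IsRoot (α ^ i.val) :=
      (rootMultiplicity_pos hg).1 (Nat.pos_of_ne_zero hcon.1)
    have h2 : h.IsRoot (α ^ (-i).val) := by
      refine (rootMultiplicity_pos hh).1 ?_
      have := hadd (-i)
      have := hcon.2
      omega
    have h3 := (hrev i).2 h2
    have := congrArg (eval (α ^ i.val)) huv
    rw [eval_add, eval_mul, eval_mul, h1.eq_zero, h3.eq_zero] at this
    simp at this
  · intro H
    refine isCoprime_of_prime_dvd (fun h => hg h.1) fun z hz h1 h2 => ?_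
    obtain ⟨i, hi⟩ := hα.exists_associated_of_prime_dvd hz (h1.trans ⟨h, hgh.symm⟩)
    have r1 : g.IsRoot (α ^ i.val) := dvd_iff_isRoot.1 (hi.dvd_iff_dvd_left.1 h1)
    have r2 := (hrev i).1 (dvd_iff_isRoot.1 (hi.dvd_iff_dvd_left.1 h2))
    have m1 := (rootMultiplicity_pos hg).2 r1
    have m2 := (rootMultiplicity_pos hh).2 r2
    have := hadd (-i)
    rcases H i with h | h <;> omega

end PrimitiveRoot

/-! ### Coset polynomials and the multiplicities of their roots. -/

section CosetPoly

variable {F E : Type*} [Field F] [Field E] [Algebra F E] {q N : ℕ} [NeZero N]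
  (hF : Nat.card F = q) (hq : q ≠ 0) {α : E} (hα : IsPrimitiveRoot α N)

/-- The reciprocal inverts roots, and inverting `α ^ i` negates the exponent; the identity is
checked over `E` and descends by injectivity. -/
theorem reciprocalPoly_cosetPoly (a : ZMod N) :
    reciprocalPoly (cosetPoly hF hq hα a) = cosetPoly hF hq hα (-a) := by
  apply map_injective (algebraMap F E) (algebraMap F E).injective
  rw [map_reciprocalPoly, map_cosetPoly, map_cosetPoly, reciprocalPoly_prod]
  refine Finset.prod_bij (fun i _ => -i) (fun i hi => neg_mem_cyclotomicCoset_neg.2 hi)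
    (fun i _ j _ h => neg_injective h)
    (fun b hb => ⟨-b, neg_mem_cyclotomicCoset.2 hb, neg_neg b⟩) fun i _ => ?_
  rw [reciprocalPoly_X_sub_C (pow_ne_zero _ (hα.ne_zero (NeZero.ne N))), hα.pow_val_neg]

theorem cosetPoly_ne_zero (a : ZMod N) : cosetPoly hF hq hα a ≠ 0 := by
  intro h
  have := map_cosetPoly hF hq hα a
  rw [h, Polynomial.map_zero] at this
  exact (monic_prod_X_sub_C _ _).ne_zero this.symm

open Classical in
theorem rootMultiplicity_map_cosetPoly (a i : ZMod N) :
    rootMultiplicity (α ^ i.val) ((cosetPoly hF hq hα a).map (algebraMap F E)) =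
      if i ∈ cyclotomicCoset q a then 1 else 0 := by
  rw [map_cosetPoly, rootMultiplicity_finsetProd _ _ _ fun j _ => X_sub_C_ne_zero _]
  simp only [rootMultiplicity_X_sub_C, hα.pow_val_injective.eq_iff]
  simp

end CosetPoly

/-! ### Multiplicities of roots in the prescribed factorization. -/

section ExponentFormula

variable {F E : Type*} [Field F] [Field E] [Algebra F E] {q N : ℕ} [NeZero N]
  (hF : Nat.card F = q) (hq : q ≠ 0) {α : E} (hα : IsPrimitiveRoot α N)

open Classical in
theorem rootMultiplicity_map_cosetPoly_prod
    (a : (d : ℕ) → Fin (numCosets q d) → ZMod N) (r : (d : ℕ) → Fin (numCosets q d) → ℕ)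
    (s s' : (d : ℕ) → Fin (numCosets q d / 2) → ℕ) (S T : Finset ℕ) (i : ZMod N) :
    rootMultiplicity (α ^ i.val) (((∏ d ∈ S, ∏ j, cosetPoly hF hq hα (a d j) ^ r d j) *
      ∏ d ∈ T, ∏ j, cosetPoly hF hq hα (a d (firstHalf j)) ^ s d j *
        reciprocalPoly (cosetPoly hF hq hα (a d (firstHalf j))) ^ s' d j).map
          (algebraMap F E)) =
      (∑ d ∈ S, ∑ j, r d j * if i ∈ cyclotomicCoset q (a d j) then 1 else 0) +
      ∑ d ∈ T, ∑ j, ((s d j * if i ∈ cyclotomicCoset q (a d (firstHalf j)) then 1 else 0) +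
        s' d j * if i ∈ cyclotomicCoset q (-a d (firstHalf j)) then 1 else 0) := by
  have hne : ∀ b : ZMod N, (cosetPoly hF hq hα b).map (algebraMap F E) ≠ 0 := fun b =>
    Polynomial.map_ne_zero (cosetPoly_ne_zero hF hq hα b)
  have hne' : ∀ (b : ZMod N) (k : ℕ), (cosetPoly hF hq hα b).map (algebraMap F E) ^ k ≠ 0 :=
    fun b k => pow_ne_zero _ (hne b)
  have hne2 : ∀ (b c : ZMod N) (k l : ℕ), (cosetPoly hF hq hα b).map (algebraMap F E) ^ k *
      (cosetPoly hF hq hα c).map (algebraMap F E) ^ l ≠ 0 :=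
    fun b c k l => mul_ne_zero (hne' b k) (hne' c l)
  have hS : ∀ d ∈ S, ∏ j, (cosetPoly hF hq hα (a d j)).map (algebraMap F E) ^ r d j ≠ 0 :=
    fun d _ => Finset.prod_ne_zero_iff.2 fun j _ => hne' _ _
  have hT : ∀ d ∈ T, ∏ j, ((cosetPoly hF hq hα (a d (firstHalf j))).map (algebraMap F E) ^ s d j *
      (cosetPoly hF hq hα (-a d (firstHalf j))).map (algebraMap F E) ^ s' d j) ≠ 0 :=
    fun d _ => Finset.prod_ne_zero_iff.2 fun j _ => hne2 _ _ _ _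
  simp only [reciprocalPoly_cosetPoly, Polynomial.map_mul, Polynomial.map_prod,
    Polynomial.map_pow]
  rw [rootMultiplicity_mul (mul_ne_zero (Finset.prod_ne_zero_iff.2 hS)
    (Finset.prod_ne_zero_iff.2 hT)), rootMultiplicity_finsetProd _ _ _ hS,
    rootMultiplicity_finsetProd _ _ _ hT]
  congr 1
  · refine Finset.sum_congr rfl fun d _ => ?_
    rw [rootMultiplicity_finsetProd _ _ _ fun j _ => hne' _ _]
    refine Finset.sum_congr rfl fun j _ => ?_
    rw [rootMultiplicity_pow_eq_mul, rootMultiplicity_map_cosetPoly]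
  · refine Finset.sum_congr rfl fun d _ => ?_
    rw [rootMultiplicity_finsetProd _ _ _ fun j _ => hne2 _ _ _ _]
    refine Finset.sum_congr rfl fun j _ => ?_
    rw [rootMultiplicity_mul (hne2 _ _ _ _), rootMultiplicity_pow_eq_mul,
      rootMultiplicity_pow_eq_mul, rootMultiplicity_map_cosetPoly,
      rootMultiplicity_map_cosetPoly]

end ExponentFormula

/-! ### Reading off exponents from a coset arrangement. -/

namespace IsCosetArrangement

variable {q N : ℕ} [NeZero N] {a : (d : ℕ) → Fin (numCosets q d) → ZMod N}

/-- Additive order is unchanged by negation and, as `q` is prime to `N`, constant on cosets; so `i`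
determines the divisor. -/
theorem eq_of_mem (ha : IsCosetArrangement q a) (hqN : q.Coprime N) {d e : ℕ} (hd : d ∣ N)
    (he : e ∣ N) {j : Fin (numCosets q d)} {k : Fin (numCosets q e)} {i : ZMod N}
    (hj : i ∈ cyclotomicCoset q (a d j) ∨ i ∈ cyclotomicCoset q (-a d j))
    (hk : i ∈ cyclotomicCoset q (a e k) ∨ i ∈ cyclotomicCoset q (-a e k)) : d = e := by
  have order : ∀ {d : ℕ} (_ : d ∣ N) {j : Fin (numCosets q d)},
      (i ∈ cyclotomicCoset q (a d j) ∨ i ∈ cyclotomicCoset q (-a d j)) → addOrderOf i = d := by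
    intro d hd j hj
    rcases hj with hj | hj
    · rw [addOrderOf_eq_of_mem_cyclotomicCoset hqN hj, ha.addOrderOf_eq d hd]
    · rw [addOrderOf_eq_of_mem_cyclotomicCoset hqN hj, addOrderOf_neg, ha.addOrderOf_eq d hd]
  rw [← order hd hj, ← order he hk]

open Classical in
theorem sum_good (ha : IsCosetArrangement q a) (hqN : q.Coprime N)
    (r : (d : ℕ) → Fin (numCosets q d) → ℕ) {S : Finset ℕ} (hS : ∀ d ∈ S, d ∣ N)
    {d : ℕ} (hd : d ∈ S) {j : Fin (numCosets q d)} {i : ZMod N}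
    (hi : i ∈ cyclotomicCoset q (a d j)) :
    (∑ e ∈ S, ∑ k, r e k * if i ∈ cyclotomicCoset q (a e k) then 1 else 0) = r d j := by
  rw [Finset.sum_eq_single d, Finset.sum_eq_single j]
  · simp [hi]
  · intro k _ hk
    rw [if_neg, mul_zero]
    intro hik
    have ho : addOrderOf i = d := by
      rw [addOrderOf_eq_of_mem_cyclotomicCoset hqN hi, ha.addOrderOf_eq d (hS d hd)]
    exact hk ((ha.existsUnique_mem d (hS d hd) i ho).unique hik hi)
  · simp
  · intro e he hne
    refine Finset.sum_eq_zero fun k _ => ?_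
    rw [if_neg, mul_zero]
    exact fun hik => hne (ha.eq_of_mem hqN (hS e he) (hS d hd) (Or.inl hik) (Or.inl hi))
  · exact fun h => absurd hd h

open Classical in
theorem sum_good_eq_zero (ha : IsCosetArrangement q a) (hqN : q.Coprime N)
    (r : (d : ℕ) → Fin (numCosets q d) → ℕ) {S : Finset ℕ} (hS : ∀ d ∈ S, d ∣ N)
    {d : ℕ} (hdN : d ∣ N) (hd : d ∉ S) {j : Fin (numCosets q d)} {i : ZMod N}
    (hi : i ∈ cyclotomicCoset q (a d j) ∨ i ∈ cyclotomicCoset q (-a d j)) :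
    (∑ e ∈ S, ∑ k, r e k * if i ∈ cyclotomicCoset q (a e k) then 1 else 0) = 0 := by
  refine Finset.sum_eq_zero fun e he => Finset.sum_eq_zero fun k _ => ?_
  rw [if_neg, mul_zero]
  intro hik
  exact hd (ha.eq_of_mem hqN (hS e he) hdN (Or.inl hik) hi ▸ he)

open Classical in
-- One pair of cosets contains `i`, and its two members are disjoint because `d` is bad, so exactly
-- one exponent survives.
theorem sum_bad (ha : IsCosetArrangement q a) (hqN : q.Coprime N)
    (s s' : (d : ℕ) → Fin (numCosets q d / 2) → ℕ) {T : Finset ℕ}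
    (hT : ∀ d ∈ T, d ∣ N ∧ d ∉ goodIntegers q 1)
    {d : ℕ} (hd : d ∈ T) {j : Fin (numCosets q d / 2)} {i : ZMod N}
    (hi : i ∈ cyclotomicCoset q (a d (firstHalf j)) ∨
      i ∈ cyclotomicCoset q (-a d (firstHalf j))) :
    (∑ e ∈ T, ∑ k, ((s e k * if i ∈ cyclotomicCoset q (a e (firstHalf k)) then 1 else 0) +
      s' e k * if i ∈ cyclotomicCoset q (-a e (firstHalf k)) then 1 else 0)) =
      if i ∈ cyclotomicCoset q (a d (firstHalf j)) then s d j else s' d j := by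
  rw [Finset.sum_eq_single d, Finset.sum_eq_single j]
  · by_cases h : i ∈ cyclotomicCoset q (a d (firstHalf j))
    · have h' : i ∉ cyclotomicCoset q (-a d (firstHalf j)) := fun h' =>
        (hT d hd).2 (ha.addOrderOf_eq d (hT d hd).1 (firstHalf j) ▸
          addOrderOf_mem_goodIntegers hqN h h')
      simp [h, h']
    · simp [h, hi.resolve_left h]
  · intro k _ hk
    have ho : addOrderOf i = d := by
      rcases hi with hi | hi
      · rw [addOrderOf_eq_of_mem_cyclotomicCoset hqN hi, ha.addOrderOf_eq d (hT d hd).1]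
      · rw [addOrderOf_eq_of_mem_cyclotomicCoset hqN hi, addOrderOf_neg,
          ha.addOrderOf_eq d (hT d hd).1]
    have hu := ha.existsUnique_pair d (hT d hd).1 (hT d hd).2 i ho
    rw [if_neg fun h => hk (hu.unique (Or.inl h) hi), if_neg fun h => hk (hu.unique (Or.inr h) hi)]
    simp
  · simp
  · intro e he hne
    refine Finset.sum_eq_zero fun k _ => ?_
    rw [if_neg fun h => hne (ha.eq_of_mem hqN (hT e he).1 (hT d hd).1 (Or.inl h) hi),
      if_neg fun h => hne (ha.eq_of_mem hqN (hT e he).1 (hT d hd).1 (Or.inr h) hi)]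
    simp
  · exact fun h => absurd hd h

open Classical in
theorem sum_bad_eq_zero (ha : IsCosetArrangement q a) (hqN : q.Coprime N)
    (s s' : (d : ℕ) → Fin (numCosets q d / 2) → ℕ) {T : Finset ℕ} (hT : ∀ d ∈ T, d ∣ N)
    {d : ℕ} (hdN : d ∣ N) (hd : d ∉ T) {j : Fin (numCosets q d)} {i : ZMod N}
    (hi : i ∈ cyclotomicCoset q (a d j)) :
    (∑ e ∈ T, ∑ k, ((s e k * if i ∈ cyclotomicCoset q (a e (firstHalf k)) then 1 else 0) +
      s' e k * if i ∈ cyclotomicCoset q (-a e (firstHalf k)) then 1 else 0)) = 0 := by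
  refine Finset.sum_eq_zero fun e he => Finset.sum_eq_zero fun k _ => ?_
  rw [if_neg fun h => hd (ha.eq_of_mem hqN (hT e he) hdN (Or.inl h) (Or.inl hi) ▸ he),
    if_neg fun h => hd (ha.eq_of_mem hqN (hT e he) hdN (Or.inr h) (Or.inl hi) ▸ he)]
  simp

/-- If the multiplicity `v` takes the values `r` on the good cosets and `s`, `s'` on the pairs of
opposite bad cosets, the condition `v i = 0 ∨ v (-i) = k` for all `i` decouples. -/
theorem forall_eq_zero_or_neg_eq_iff (ha : IsCosetArrangement q a) {k : ℕ} (hk : k ≠ 0)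
    {v : ZMod N → ℕ} {r : (d : ℕ) → Fin (numCosets q d) → ℕ}
    {s s' : (d : ℕ) → Fin (numCosets q d / 2) → ℕ}
    (hr : ∀ d, d ∣ N → d ∈ goodIntegers q 1 → ∀ j, ∀ i ∈ cyclotomicCoset q (a d j), v i = r d j)
    (hs : ∀ d, d ∣ N → d ∉ goodIntegers q 1 → ∀ j,
      ∀ i ∈ cyclotomicCoset q (a d (firstHalf j)), v i = s d j)
    (hs' : ∀ d, d ∣ N → d ∉ goodIntegers q 1 → ∀ j,
      ∀ i ∈ cyclotomicCoset q (-a d (firstHalf j)), v i = s' d j) :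
    (∀ i, v i = 0 ∨ v (-i) = k) ↔
      (∀ d, d ∣ N → d ∈ goodIntegers q 1 → ∀ j, r d j ∈ ({0, k} : Set ℕ)) ∧
      (∀ d, d ∣ N → d ∉ goodIntegers q 1 →
        ∀ j, (s d j, s' d j) ∈ ({(0, 0), (k, k)} : Set (ℕ × ℕ))) := by
  simp only [Set.mem_insert_iff, Set.mem_singleton_iff, Prod.mk.injEq]
  constructor
  · intro H
    refine ⟨fun d hd hG j => ?_, fun d hd hG j => ?_⟩
    · have h1 := mem_cyclotomicCoset_self (q := q) (a d j)
      have h2 := neg_mem_cyclotomicCoset_of_mem_goodIntegers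
        ((ha.addOrderOf_eq d hd j).symm ▸ hG) h1
      have := H (a d j)
      rwa [hr d hd hG j _ h1, hr d hd hG j _ h2] at this
    · have h1 := hs d hd hG j _ (mem_cyclotomicCoset_self _)
      have h2 := hs' d hd hG j _ (mem_cyclotomicCoset_self _)
      have h3 := H (a d (firstHalf j))
      have h4 := H (-a d (firstHalf j))
      rw [neg_neg] at h4
      rw [h1, h2] at h3 h4
      -- The conditions are `s = 0 ∨ s' = k` and `s' = 0 ∨ s = k`; as `k ≠ 0`, the mixed cases are
      -- impossible.
      omega
  · rintro ⟨H1, H2⟩ i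
    have hd := ZMod.addOrderOf_dvd_modulus i
    by_cases hG : addOrderOf i ∈ goodIntegers q 1
    · obtain ⟨j, hj, -⟩ := ha.existsUnique_mem _ hd i rfl
      have h2 := neg_mem_cyclotomicCoset_of_mem_goodIntegers
        ((ha.addOrderOf_eq _ hd j).symm ▸ hG) hj
      rw [hr _ hd hG j _ hj, hr _ hd hG j _ h2]
      exact H1 _ hd hG j
    · obtain ⟨j, hj, -⟩ := ha.existsUnique_pair _ hd hG i rfl
      have := H2 _ hd hG j
      rcases hj with hj | hj
      · rw [hs _ hd hG j _ hj, hs' _ hd hG j _ (neg_mem_cyclotomicCoset_neg.2 hj)]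
        omega
      · rw [hs' _ hd hG j _ hj, hs _ hd hG j _ (neg_mem_cyclotomicCoset.2 hj)]
        omega

end IsCosetArrangement

/-! ### The main theorem. -/

theorem map_reverse_of_field {F E : Type*} [Field F] [Field E] (φ : F →+* E) (f : F[X]) :
    f.reverse.map φ = (f.map φ).reverse := by
  rw [reverse, reverse, reflect_map, natDegree_map]

open Classical in
theorem theorem4 {F E : Type*} [Field F] [Field E] [Algebra F E]
    (p m N t n : ℕ) [NeZero N] (hp : p.Prime) (hm : 0 < m) (hF : Nat.card F = p ^ m)
    (hpN : ¬ p ∣ N) (hn : n = N * p ^ t)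
    (α : E) (hα : IsPrimitiveRoot α N)
    (a : (d : ℕ) → Fin (numCosets (p ^ m) d) → ZMod N)
    (ha : IsCosetArrangement (p ^ m) a)
    (C : Submodule F (Fin n → F)) (hC : IsCyclicCode C)
    (g : F[X]) (hg : IsGeneratorPolynomial C g)
    (r : (d : ℕ) → Fin (numCosets (p ^ m) d) → ℕ)
    (s s' : (d : ℕ) → Fin (numCosets (p ^ m) d / 2) → ℕ)
    (f : ZMod N → F[X]) (hf : f = cosetPoly hF (pow_ne_zero m hp.ne_zero) hα)
    (hgf : g =
      (∏ d ∈ N.divisors with d ∈ goodIntegers (p ^ m : ℕ) 1,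
        ∏ j, f (a d j) ^ r d j) *
      ∏ d ∈ N.divisors with d ∉ goodIntegers (p ^ m : ℕ) 1,
        ∏ j, f (a d (firstHalf j)) ^ s d j *
          reciprocalPoly (f (a d (firstHalf j))) ^ s' d j) :
    IsEuclideanComplementaryDual C ↔
      (∀ d, d ∣ N → d ∈ goodIntegers (p ^ m : ℕ) 1 →
        ∀ j, r d j ∈ ({0, p ^ t} : Set ℕ)) ∧
      (∀ d, d ∣ N → d ∉ goodIntegers (p ^ m : ℕ) 1 →
        ∀ j, (s d j, s' d j) ∈ ({(0, 0), (p ^ t, p ^ t)} : Set (ℕ × ℕ))) := by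
  have : Fact p.Prime := ⟨hp⟩
  have hq0 : p ^ m ≠ 0 := pow_ne_zero m hp.ne_zero
  have : Finite F := Nat.finite_of_card_ne_zero (hF ▸ hq0)
  have := Fintype.ofFinite F
  have : CharP F p := charP_of_card_eq_prime_pow (Nat.card_eq_fintype_card (α := F) ▸ hF)
  have hqN : (p ^ m).Coprime N := ((hp.coprime_iff_not_dvd).2 hpN).pow_left m
  have hn0 : 0 < n := hn ▸ Nat.mul_pos (Nat.pos_of_neZero N) (pow_pos hp.pos t)
  have hX : (X ^ n - 1 : F[X]) = (X ^ N - 1) ^ p ^ t := by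
    rw [sub_pow_char_pow, one_pow, ← pow_mul, hn]
  obtain ⟨h, hh⟩ := hg.dvd
  have hmap : g.map (algebraMap F E) * h.map (algebraMap F E) = (X ^ N - 1) ^ p ^ t := by
    rw [← Polynomial.map_mul, ← hh, hX]
    simp
  -- Coprimality is unaffected by extending the field, so it can be tested over `E`, where `X ^ N -
  -- 1` splits.
  rw [isEuclideanComplementaryDual_iff_isCoprime hn0 hg hh.symm,
    ← isCoprime_map (algebraMap F E), map_reverse_of_field,
    isCoprime_reverse_iff_rootMultiplicity hα hmap]
  have hS : ∀ d ∈ N.divisors.filter (· ∈ goodIntegers (p ^ m : ℕ) 1), d ∣ N := fun d hd =>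
    Nat.dvd_of_mem_divisors (Finset.mem_filter.1 hd).1
  have hT : ∀ d ∈ N.divisors.filter (· ∉ goodIntegers (p ^ m : ℕ) 1),
      d ∣ N ∧ d ∉ goodIntegers (p ^ m : ℕ) 1 := fun d hd =>
    ⟨Nat.dvd_of_mem_divisors (Finset.mem_filter.1 hd).1, (Finset.mem_filter.1 hd).2⟩
  have hN := NeZero.ne N
  refine ha.forall_eq_zero_or_neg_eq_iff (pow_ne_zero t hp.ne_zero) (v := fun i =>
    rootMultiplicity (α ^ i.val) (g.map (algebraMap F E))) ?_ ?_ ?_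
  · intro d hd hG j i hi
    simp only [hgf, hf, rootMultiplicity_map_cosetPoly_prod]
    rw [ha.sum_good hqN r hS (Finset.mem_filter.2 ⟨Nat.mem_divisors.2 ⟨hd, hN⟩, hG⟩) hi,
      ha.sum_bad_eq_zero hqN s s' (fun e he => (hT e he).1) hd
        (fun h => (Finset.mem_filter.1 h).2 hG) hi, add_zero]
  · intro d hd hG j i hi
    simp only [hgf, hf, rootMultiplicity_map_cosetPoly_prod]
    rw [ha.sum_good_eq_zero hqN r hS hd (fun h => hG (Finset.mem_filter.1 h).2) (Or.inl hi),
      ha.sum_bad hqN s s' hT (Finset.mem_filter.2 ⟨Nat.mem_divisors.2 ⟨hd, hN⟩, hG⟩) (Or.inl hi),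
      if_pos hi, zero_add]
  · intro d hd hG j i hi
    simp only [hgf, hf, rootMultiplicity_map_cosetPoly_prod]
    have hi' : i ∉ cyclotomicCoset (p ^ m) (a d (firstHalf j)) := fun h =>
      hG (ha.addOrderOf_eq d hd (firstHalf j) ▸ addOrderOf_mem_goodIntegers hqN h hi)
    rw [ha.sum_good_eq_zero hqN r hS hd (fun h => hG (Finset.mem_filter.1 h).2) (Or.inr hi),
      ha.sum_bad hqN s s' hT (Finset.mem_filter.2 ⟨Nat.mem_divisors.2 ⟨hd, hN⟩, hG⟩) (Or.inr hi),
      if_neg hi', zero_add]
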